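/- **Theorem.** Let $L\ge 1$, let $\mathcal X$ be a finite set of non-negative integers, and let $\mathcal D_1,\dots,\mathcal D_L$ be probability distributions (arms) on $\mathcal X$. Let $k\ge 1$. For a finite multiset $S$ of elements of $\mathcal X$ let $S_{(j)}$ be its $j$-th largest element, counted with multiplicity ($S_{(j)}=0$ if $|S|<j$), and let $\mathrm{STK}(S)=\sum_{j=1}^{k}S_{(j)}$ be the sum of its (up to) $k$ largest elements. Start with $S_0=\emptyset$. In iteration $t=1,2,\dots$ an adaptive algorithm chooses an arm $l_t\in\{1,\dots,L\}$, possibly at random, depending on the arms and scores of the previous iterations; then a fresh score $x_t\sim\mathcal D_{l_t}$ is drawn, independently of the past given $l_t$, and $S_t=S_{t-1}+\{x_t\}$. Let $\mathrm{OPT}=\mathrm{OPT}(T)$ be the largest value of $\mathbb E[\mathrm{STK}(S_T)]$ over all adaptive algorithms; these may depend on $\mathcal D_1,\dots,\mathcal D_L$, $k$ and $T$. The $\varepsilon$-greedy algorithm, which knows neither the distributions nor $T$, acts as follows in iteration $t$. With probability $\varepsilon_t=t^{-1/3}$ it chooses an arm uniformly at random. Otherwise it chooses an arm $l$ that maximizes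 the estimated expected marginal gain $$\sum_{x\in\mathcal X}\frac{N_{l,x}}{N_l}\,\max\bigl(x-(S_{t-1})_{(k)},\,0\bigr),$$ where $N_l$ is the number of earlier iterations in which arm $l$ was sampled and $N_{l,x}$ is the number of those that returned the score $x$; the estimate is $0$ if $N_l=0$, and ties are broken arbitrarily, possibly at random. Then for every $T\ge 1$ the $\varepsilon$-greedy algorithm satisfies $$\mathbb E[\mathrm{STK}(S_T)]\;\ge\;\Bigl(1-e^{-1-\frac1{2T}}\Bigr)\,\mathrm{OPT}\;-\;\tilde O\bigl(T^{2/3}\bigr).$$ Here $\tilde O(T^{2/3})$ stands for a quantity at most $C\,T^{2/3}(1+\log T)^p$, where $p$ is an absolute constant and $C$ depends only on $L$ and $\mathcal X$, not on the distributions, on $k$, on $T$ or on the tie-breaking. -/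

import Mathlib

open scoped NNReal ENNReal

noncomputable section

namespace TopKBandit

/-- The `k`-th largest element (`k ≥ 1`) of a multiset of scores, counted with multiplicity;
it is `0` when the multiset has fewer than `k` elements. -/
def kthLargest (k : ℕ) (S : Multiset ℕ) : ℕ :=
  (S.sort (· ≥ ·)).getD (k - 1) 0

/-- Sum of the (up to) `k` largest elements of a multiset of scores. -/
def stk (k : ℕ) (S : Multiset ℕ) : ℕ :=
  ((S.sort (· ≥ ·)).take k).sum

/-- What has been observed in the first `t` iterations with `L` arms and score domain `X`:
in each iteration, the arm that was sampled and the score that it returned. -/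
abbrev History (L : ℕ) (X : Finset ℕ) (t : ℕ) : Type :=
  Fin t → Fin L × X

/-- The multiset `S_t` of all scores sampled so far. -/
def scores {L : ℕ} {X : Finset ℕ} {t : ℕ} (h : History L X t) : Multiset ℕ :=
  (Finset.univ : Finset (Fin t)).val.map fun i => ((h i).2 : ℕ)

/-- An adaptive, possibly randomized, algorithm: the law of the next arm given the history. -/
abbrev Policy (L : ℕ) (X : Finset ℕ) : Type :=
  (t : ℕ) → History L X t → PMF (Fin L)

/-- The law of the history after `t` iterations of the algorithm `π`, when arm `l` returns
independent scores with distribution `D l`. -/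
def historyLaw {L : ℕ} {X : Finset ℕ} (D : Fin L → PMF X) (π : Policy L X) :
    (t : ℕ) → PMF (History L X t)
  | 0 => PMF.pure Fin.elim0
  | t + 1 =>
    (historyLaw D π t).bind fun h =>
      (π t h).bind fun l =>
        (D l).bind fun x =>
          PMF.pure (Fin.snoc (α := fun _ => Fin L × X) h (l, x))

/-- `𝔼[STK(S_T)]` for the algorithm `π` (a finite sum, as there are finitely many histories). -/
def expectedSTK {L : ℕ} {X : Finset ℕ} (D : Fin L → PMF X) (k : ℕ) (π : Policy L X)
    (T : ℕ) : ℝ :=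
  ∑ h : History L X T, (historyLaw D π T h).toReal * (stk k (scores h) : ℝ)

/-- `OPT`: the optimal value of `𝔼[STK(S_T)]` over all adaptive algorithms; these may depend on
the distributions `D`, on `k` and on `T`. -/
def OPT {L : ℕ} {X : Finset ℕ} (D : Fin L → PMF X) (k T : ℕ) : ℝ :=
  ⨆ π : Policy L X, expectedSTK D k π T

/-- The supremum that defines `OPT` is over a bounded family. -/
theorem bddAbove_expectedSTK {L : ℕ} {X : Finset ℕ} (D : Fin L → PMF X) (k T : ℕ) :
    BddAbove (Set.range fun π : Policy L X => expectedSTK D k π T) := by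
  refine ⟨∑ h : History L X T, (stk k (scores h) : ℝ), ?_⟩
  rintro _ ⟨π, rfl⟩
  refine Finset.sum_le_sum fun h _ => ?_
  refine mul_le_of_le_one_left (Nat.cast_nonneg _) ?_
  exact ENNReal.toReal_le_of_le_ofReal zero_le_one (by simpa using PMF.coe_le_one _ h)

/-- `N_l`: how often arm `l` has been sampled. -/
def visits {L : ℕ} {X : Finset ℕ} {t : ℕ} (h : History L X t) (l : Fin L) : ℕ :=
  (Finset.univ.filter fun i : Fin t => (h i).1 = l).card

/-- `N_{l,x}`: how often arm `l` has been sampled and has returned the score `x`. -/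
def visitsWith {L : ℕ} {X : Finset ℕ} {t : ℕ} (h : History L X t) (l : Fin L) (x : X) : ℕ :=
  (Finset.univ.filter fun i : Fin t => h i = (l, x)).card

/-- The estimated expected marginal gain in STK from sampling arm `l`,
`∑ x, N_{l,x} / N_l * max (x - S_(k)) 0`. The estimate of an arm that was never sampled
(whose histogram is empty) is `0`. -/
def estimatedGain {L : ℕ} {X : Finset ℕ} {t : ℕ} (k : ℕ) (h : History L X t) (l : Fin L) : ℝ :=
  ∑ x : X, (visitsWith h l x : ℝ) / (visits h l : ℝ) *
    max (((x : ℕ) : ℝ) - (kthLargest k (scores h) : ℝ)) 0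

/-- `g` is a greedy rule: it only chooses arms that maximize the estimated gain. Ties may be
broken in any way, also at random. -/
def IsGreedyRule {L : ℕ} {X : Finset ℕ} (k : ℕ) (g : Policy L X) : Prop :=
  ∀ (t : ℕ) (h : History L X t), ∀ l ∈ (g t h).support,
    ∀ l' : Fin L, estimatedGain k h l' ≤ estimatedGain k h l

/-- The exploration rate `ε_t = t ^ (-1/3)`; iterations are numbered from `1`. -/
def explorationRate (t : ℕ) : ℝ≥0 :=
  (t : ℝ≥0) ^ (-(1 / 3) : ℝ)

theorem explorationRate_le_one (t : ℕ) : explorationRate (t + 1) ≤ 1 :=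
  NNReal.rpow_le_one_of_one_le_of_nonpos (by simp) (by norm_num)

/-- A coin that shows `true` (explore) with probability `ε_{t+1}`. -/
def explorationCoin (t : ℕ) : PMF Bool :=
  PMF.ofFintype
    (fun b => cond b (explorationRate (t + 1) : ℝ≥0∞) (1 - (explorationRate (t + 1) : ℝ≥0∞)))
    (by simpa using add_tsub_cancel_of_le (ENNReal.coe_le_one_iff.2 (explorationRate_le_one t)))

/-- The `ε`-greedy algorithm with greedy rule `g`: after `t` iterations, iteration `t + 1`
explores a uniformly random arm with probability `ε_{t+1}`, and otherwise follows `g`. -/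
def epsGreedy {L : ℕ} [NeZero L] {X : Finset ℕ} (g : Policy L X) : Policy L X :=
  fun t h => (explorationCoin t).bind fun explore =>
    if explore then PMF.uniformOfFintype (Fin L) else g t h

end TopKBandit

end

/-!
Fix `T`. If the `k`-th largest score so far is `c` and every arm has expected gain at most `G` over
`c`, then no algorithm collects more than `k c + T G`, whereas the current value is already at least
`k c`. Hence the best arm gains at least `(OPT - STK(S)) / T`, and `ε`-greedy gains at least as much
up to `max X · ε_t` (for exploring) and twice the error of its estimates. So the regret
`a_t = OPT - 𝔼[STK(S_t)]` satisfies `a_{t+1} ≤ (1 - 1/T) a_t + O(ε_{t+1} (1 + log t))`, and the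
theorem follows from `(1 - 1/T)^T ≤ exp (-1 - 1/(2T))` and `∑ ε_t = O(T^(2/3))`.

The estimates are controlled by two moments. For the martingale `d = N_{l,x} - D_l(x) N_l`, the
process `d² / (N_l + 1) - (1 + 1/2 + ⋯ + 1/N_l)` is a supermartingale, so
`𝔼[d² / (N_l + 1)] ≤ 1 + log t`. Exploration makes `u_t = 𝔼[1 / (N_l + 1)]` decrease by at least
`(ε_{t+1} / 2L) u_t²`, by Jensen's inequality, whence `u_t = O(ε_{t+1}²)`. The mean error
`𝔼[|d| / (N_l + 1)]` is at most the geometric mean of the two, hence of order `ε_{t+1}` up to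
logarithms.
-/

namespace TopKBandit

section Expectation

variable {α β : Type*}

theorem toReal_apply_le_one (p : PMF α) (a : α) : (p a).toReal ≤ 1 :=
  ENNReal.toReal_mono ENNReal.one_ne_top (p.coe_le_one a)

variable [Fintype α] [Fintype β]

theorem sum_toReal_apply_eq_one (p : PMF α) : ∑ a, (p a).toReal = 1 := by
  rw [← ENNReal.toReal_sum fun a _ => p.apply_ne_top a,
    ← tsum_fintype (L := .unconditional α) (fun a => p a), p.tsum_coe, ENNReal.toReal_one]

/-- The expectation of a real function under a probability mass function on a finite type. It is a
finite sum, rather than an integral, so that `expectedSTK` is an instance by definition. -/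
noncomputable def expect (p : PMF α) (f : α → ℝ) : ℝ :=
  ∑ a, (p a).toReal * f a

theorem expect_const (p : PMF α) (c : ℝ) : expect p (fun _ => c) = c := by
  rw [expect, ← Finset.sum_mul, sum_toReal_apply_eq_one, one_mul]

theorem expect_add (p : PMF α) (f g : α → ℝ) :
    expect p (fun a => f a + g a) = expect p f + expect p g := by
  simp only [expect, mul_add, Finset.sum_add_distrib]

theorem expect_sub (p : PMF α) (f g : α → ℝ) :
    expect p (fun a => f a - g a) = expect p f - expect p g := by
  simp only [expect, mul_sub, Finset.sum_sub_distrib]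

theorem expect_const_mul (p : PMF α) (c : ℝ) (f : α → ℝ) :
    expect p (fun a => c * f a) = c * expect p f := by
  simp only [expect, Finset.mul_sum, mul_left_comm]

theorem expect_sum {ι : Type*} (s : Finset ι) (p : PMF α) (f : ι → α → ℝ) :
    expect p (fun a => ∑ i ∈ s, f i a) = ∑ i ∈ s, expect p (f i) := by
  simp only [expect, Finset.mul_sum]
  exact Finset.sum_comm

theorem expect_ite_eq [DecidableEq α] (p : PMF α) (a : α) (c : ℝ) :
    expect p (fun b => if b = a then c else 0) = (p a).toReal * c := by
  simp [expect]

theorem expect_pure (a : α) (f : α → ℝ) : expect (PMF.pure a) f = f a := by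
  classical
  simp [expect, PMF.pure_apply, apply_ite ENNReal.toReal]

theorem expect_bind (p : PMF α) (q : α → PMF β) (f : β → ℝ) :
    expect (p.bind q) f = expect p fun a => expect (q a) f := by
  have toReal_bind (b : β) : (p.bind q b).toReal = ∑ a, (p a).toReal * (q a b).toReal := by
    rw [PMF.bind_apply, tsum_fintype, ENNReal.toReal_sum fun a _ =>
      ENNReal.mul_ne_top (p.apply_ne_top a) ((q a).apply_ne_top b)]
    simp only [ENNReal.toReal_mul]
  simp only [expect, toReal_bind, Finset.sum_mul, Finset.mul_sum, mul_assoc]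
  exact Finset.sum_comm

theorem expect_mono_support (p : PMF α) {f g : α → ℝ} (h : ∀ a ∈ p.support, f a ≤ g a) :
    expect p f ≤ expect p g := by
  refine Finset.sum_le_sum fun a _ => ?_
  by_cases ha : a ∈ p.support
  · exact mul_le_mul_of_nonneg_left (h a ha) ENNReal.toReal_nonneg
  · simp [(p.apply_eq_zero_iff a).2 ha]

theorem expect_mono (p : PMF α) {f g : α → ℝ} (h : ∀ a, f a ≤ g a) : expect p f ≤ expect p g :=
  expect_mono_support p fun a _ => h a

theorem expect_le_of_forall_le (p : PMF α) {f : α → ℝ} {c : ℝ} (h : ∀ a, f a ≤ c) :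
    expect p f ≤ c :=
  (expect_mono p h).trans_eq (expect_const p c)

theorem expect_nonneg (p : PMF α) {f : α → ℝ} (h : ∀ a, 0 ≤ f a) : 0 ≤ expect p f :=
  Finset.sum_nonneg fun a _ => mul_nonneg ENNReal.toReal_nonneg (h a)

theorem map_expect_le {φ : ℝ → ℝ} (hφ : ConvexOn ℝ Set.univ φ) (p : PMF α) (f : α → ℝ) :
    φ (expect p f) ≤ expect p fun a => φ (f a) :=
  hφ.map_sum_le (fun _ _ => ENNReal.toReal_nonneg) (sum_toReal_apply_eq_one p)
    fun _ _ => Set.mem_univ _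

theorem le_expect_add_two_mul_sum_abs_sub (p : PMF α) {u v : α → ℝ}
    (hp : ∀ a ∈ p.support, ∀ b, u b ≤ u a) (b : α) :
    v b ≤ expect p v + 2 * ∑ a, |u a - v a| := by
  have abs_le_sum (a : α) : |u a - v a| ≤ ∑ a, |u a - v a| :=
    Finset.single_le_sum (f := fun a => |u a - v a|) (fun _ _ => abs_nonneg _) (Finset.mem_univ a)
  have le_on_support : expect p (fun _ => v b - 2 * ∑ a, |u a - v a|) ≤ expect p v :=
    expect_mono_support p fun a ha => by
      linarith [hp a ha b, abs_le_sum a, abs_le_sum b, le_abs_self (u a - v a),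
        neg_abs_le (u b - v b)]
  rw [expect_const] at le_on_support
  linarith

end Expectation

section TopK

section List

variable {α : Type*} [AddCommMonoid α]

theorem sum_take_succ_eq_add_getD (l : List α) (k : ℕ) :
    (l.take (k + 1)).sum = (l.take k).sum + l.getD k 0 := by
  rw [List.take_add_one, List.sum_append, List.getD_eq_getElem?_getD]
  cases l[k]? <;> simp

variable [LinearOrder α] [CanonicallyOrderedAdd α]

theorem getD_zero_le_of_forall_mem_le {l : List α} {b : α} (h : ∀ a ∈ l, a ≤ b) (k : ℕ) :
    l.getD k 0 ≤ b := by
  rw [List.getD_eq_getElem?_getD]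
  cases hk : l[k]? with
  | none => exact zero_le
  | some a => exact h a (List.mem_of_getElem? hk)

theorem succ_nsmul_getD_le_sum_take [IsOrderedAddMonoid α] {l : List α}
    (hl : l.Pairwise (· ≥ ·)) (k : ℕ) : (k + 1) • l.getD k 0 ≤ (l.take (k + 1)).sum := by
  induction l generalizing k with
  | nil => simp
  | cons b l ih =>
    obtain ⟨hb, hl⟩ := List.pairwise_cons.1 hl
    cases k with
    | zero => simp
    | succ k =>
      rw [List.getD_cons_succ, List.take_succ_cons, List.sum_cons, succ_nsmul']
      exact add_le_add (getD_zero_le_of_forall_mem_le hb k) (ih hl k)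

variable [Sub α] [OrderedSub α]

theorem sum_take_orderedInsert {l : List α} (hl : l.Pairwise (· ≥ ·)) (x : α) (k : ℕ) :
    ((l.orderedInsert (· ≥ ·) x).take (k + 1)).sum
      = (l.take (k + 1)).sum + (x - l.getD k 0) := by
  induction l generalizing k with
  | nil => simp
  | cons b l ih =>
    obtain ⟨hb, hl⟩ := List.pairwise_cons.1 hl
    by_cases hxb : x ≥ b
    · have getD_le : (b :: l).getD k 0 ≤ x :=
        getD_zero_le_of_forall_mem_le
          (List.forall_mem_cons.2 ⟨hxb, fun a ha => (hb a ha).trans hxb⟩) k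
      rw [List.orderedInsert_cons_of_le _ _ hxb, List.take_succ_cons, List.sum_cons,
        sum_take_succ_eq_add_getD, add_assoc, add_tsub_cancel_of_le getD_le, add_comm]
    · rw [List.orderedInsert_of_not_le _ _ hxb, List.take_succ_cons, List.take_succ_cons,
        List.sum_cons, List.sum_cons]
      cases k with
      | zero => simp [tsub_eq_zero_of_le (not_le.1 hxb).le]
      | succ k => rw [ih hl k, List.getD_cons_succ, add_assoc]

theorem sum_take_le_nsmul_add_sum_tsub [IsOrderedAddMonoid α] (l : List α) (k : ℕ) (c : α) :
    (l.take k).sum ≤ k • c + (l.map fun x => x - c).sum := by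
  induction l generalizing k with
  | nil => simp
  | cons b l ih =>
    cases k with
    | zero => simp
    | succ k =>
      calc ((b :: l).take (k + 1)).sum = b + (l.take k).sum := by simp
        _ ≤ (c + (b - c)) + (k • c + (l.map fun x => x - c).sum) :=
          add_le_add le_add_tsub (ih k)
        _ = (k + 1) • c + ((b :: l).map fun x => x - c).sum := by
          rw [succ_nsmul', List.map_cons, List.sum_cons, add_add_add_comm]

end List

theorem sort_cons_eq_orderedInsert {α : Type*} (r : α → α → Prop) [DecidableRel r] [IsTrans α r]
    [Std.Antisymm r] [Std.Total r] (a : α) (s : Multiset α) :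
    (a ::ₘ s).sort r = (s.sort r).orderedInsert r a := by
  refine List.Perm.eq_of_pairwise' (Multiset.pairwise_sort _ _)
    ((Multiset.pairwise_sort s r).orderedInsert _ _) (Multiset.coe_eq_coe.1 ?_)
  rw [Multiset.sort_eq, Multiset.coe_eq_coe.2 (List.perm_orderedInsert r a (s.sort r)),
    ← Multiset.cons_coe, Multiset.sort_eq]

theorem stk_cons {k : ℕ} (hk : 1 ≤ k) (x : ℕ) (S : Multiset ℕ) :
    stk k (x ::ₘ S) = stk k S + (x - kthLargest k S) := by
  obtain ⟨k, rfl⟩ := Nat.exists_eq_add_of_le' hk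
  rw [stk, sort_cons_eq_orderedInsert, sum_take_orderedInsert (Multiset.pairwise_sort S _)]
  rfl

theorem mul_kthLargest_le_stk {k : ℕ} (hk : 1 ≤ k) (S : Multiset ℕ) :
    k * kthLargest k S ≤ stk k S := by
  obtain ⟨k, rfl⟩ := Nat.exists_eq_add_of_le' hk
  exact succ_nsmul_getD_le_sum_take (Multiset.pairwise_sort S _) k

theorem stk_le_mul_add_sum_tsub (k c : ℕ) (S : Multiset ℕ) :
    stk k S ≤ k * c + (S.map fun x => x - c).sum := by
  have h := sum_take_le_nsmul_add_sum_tsub (S.sort (· ≥ ·)) k c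
  rwa [← Multiset.sum_coe (List.map _ _), ← Multiset.map_coe, Multiset.sort_eq] at h

end TopK

section History

variable {L : ℕ} {X : Finset ℕ} {t : ℕ}

/-- The history `h` followed by an iteration that sampled the arm `a.1` and returned `a.2`, as in
the recursion that defines `historyLaw`. -/
abbrev extend (h : History L X t) (a : Fin L × X) : History L X (t + 1) :=
  Fin.snoc (α := fun _ => Fin L × X) h a

theorem scores_extend (h : History L X t) (a : Fin L × X) :
    scores (extend h a) = (a.2 : ℕ) ::ₘ scores h := by
  rw [scores, Fin.univ_castSuccEmb, Finset.cons_val, Multiset.map_cons, Finset.map_val,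
    Multiset.map_map]
  simp [scores, Function.comp_def]

theorem visits_extend (h : History L X t) (a : Fin L × X) (l : Fin L) :
    visits (extend h a) l = visits h l + if a.1 = l then 1 else 0 := by
  simp only [visits, Finset.card_filter, Fin.sum_univ_castSucc, Fin.snoc_castSucc, Fin.snoc_last]

theorem visitsWith_extend (h : History L X t) (a : Fin L × X) (l : Fin L) (x : X) :
    visitsWith (extend h a) l x = visitsWith h l x + if a = (l, x) then 1 else 0 := by
  simp only [visitsWith, Finset.card_filter, Fin.sum_univ_castSucc, Fin.snoc_castSucc,
    Fin.snoc_last]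

theorem visits_le (h : History L X t) (l : Fin L) : visits h l ≤ t := by
  simpa [visits] using Finset.card_filter_le (Finset.univ : Finset (Fin t)) fun i => (h i).1 = l

theorem visitsWith_le_visits (h : History L X t) (l : Fin L) (x : X) :
    visitsWith h l x ≤ visits h l :=
  Finset.card_le_card (Finset.monotone_filter_right _ fun _ _ hi => congrArg Prod.fst hi)

theorem expect_historyLaw_zero (D : Fin L → PMF X) (π : Policy L X) (f : History L X 0 → ℝ) :
    expect (historyLaw D π 0) f = f Fin.elim0 := by
  simp only [historyLaw, expect_pure]

theorem expect_historyLaw_succ (D : Fin L → PMF X) (π : Policy L X) (t : ℕ)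
    (f : History L X (t + 1) → ℝ) :
    expect (historyLaw D π (t + 1)) f = expect (historyLaw D π t) fun h =>
      expect (π t h) fun l => expect (D l) fun x => f (extend h (l, x)) := by
  simp only [historyLaw, expect_bind, expect_pure]

theorem expect_historyLaw_le_of_supermartingale (D : Fin L → PMF X) (π : Policy L X)
    {f : (t : ℕ) → History L X t → ℝ}
    (hf : ∀ t h l, expect (D l) (fun x => f (t + 1) (extend h (l, x))) ≤ f t h) (t : ℕ) :
    expect (historyLaw D π t) (f t) ≤ f 0 Fin.elim0 := by
  induction t with
  | zero => rw [expect_historyLaw_zero]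
  | succ t ih =>
    rw [expect_historyLaw_succ]
    exact (expect_mono _ fun h => expect_le_of_forall_le _ (hf t h)).trans ih

end History

section Gain

variable {L : ℕ} {X : Finset ℕ}

/-- The largest score in `X`, or `0` if `X` is empty; it bounds every marginal gain. -/
def maxScore (X : Finset ℕ) : ℕ :=
  X.sup id

theorem natCast_tsub_eq_max (a b : ℕ) : ((a - b : ℕ) : ℝ) = max ((a : ℝ) - b) 0 := by
  rcases le_total b a with h | h <;> simp [h]

theorem tsub_le_maxScore (x : X) (c : ℕ) : (x : ℕ) - c ≤ maxScore X :=
  (Nat.sub_le _ _).trans (Finset.le_sup (f := id) x.2)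

/-- The expected marginal gain of sampling the arm `l` when the `k`-th largest score is `c`. The
subtraction of natural numbers encodes the positive part. -/
noncomputable def gain (D : Fin L → PMF X) (c : ℕ) (l : Fin L) : ℝ :=
  expect (D l) fun x => (((x : ℕ) - c : ℕ) : ℝ)

theorem gain_nonneg (D : Fin L → PMF X) (c : ℕ) (l : Fin L) : 0 ≤ gain D c l :=
  expect_nonneg _ fun _ => Nat.cast_nonneg _

theorem gain_le_maxScore (D : Fin L → PMF X) (c : ℕ) (l : Fin L) : gain D c l ≤ maxScore X :=
  expect_le_of_forall_le _ fun x => Nat.cast_le.2 (tsub_le_maxScore x c)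

theorem expectedSTK_eq_expect (D : Fin L → PMF X) (k : ℕ) (π : Policy L X) (t : ℕ) :
    expectedSTK D k π t = expect (historyLaw D π t) fun h => (stk k (scores h) : ℝ) := rfl

theorem expectedSTK_zero (D : Fin L → PMF X) (k : ℕ) (π : Policy L X) :
    expectedSTK D k π 0 = 0 := by
  simp [expectedSTK_eq_expect, expect_historyLaw_zero, scores, stk]

theorem expectedSTK_succ (D : Fin L → PMF X) {k : ℕ} (hk : 1 ≤ k) (π : Policy L X) (t : ℕ) :
    expectedSTK D k π (t + 1) = expectedSTK D k π t
      + expect (historyLaw D π t) fun h =>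
          expect (π t h) (gain D (kthLargest k (scores h))) := by
  simp only [expectedSTK_eq_expect, expect_historyLaw_succ, scores_extend, stk_cons hk,
    Nat.cast_add, expect_add, expect_const]
  rfl

theorem expect_sum_tsub_scores_le (D : Fin L → PMF X) (π : Policy L X) (c : ℕ) {G : ℝ}
    (hG : ∀ l, gain D c l ≤ G) (t : ℕ) :
    expect (historyLaw D π t) (fun h => ((((scores h).map fun x => x - c).sum : ℕ) : ℝ))
      ≤ t * G := by
  have supermartingale := expect_historyLaw_le_of_supermartingale D π
    (f := fun t h => ((((scores h).map fun x => x - c).sum : ℕ) : ℝ) - t * G)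
    (fun t h l => by
      simp only [scores_extend, Multiset.map_cons, Multiset.sum_cons, Nat.cast_add, Nat.cast_one,
        expect_sub, expect_add, expect_const]
      linarith [show expect (D l) (fun x => (((x : ℕ) - c : ℕ) : ℝ)) ≤ G from hG l])
    t
  rw [expect_sub, expect_const] at supermartingale
  simpa [scores] using supermartingale

theorem OPT_nonneg (D : Fin L → PMF X) (k T : ℕ) : 0 ≤ OPT D k T :=
  Real.iSup_nonneg fun _ => expect_nonneg _ fun _ => Nat.cast_nonneg _

theorem OPT_le_mul_add_mul [NeZero L] (D : Fin L → PMF X) (k c : ℕ) {G : ℝ}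
    (hG : ∀ l, gain D c l ≤ G) (T : ℕ) : OPT D k T ≤ k * c + T * G := by
  have : Nonempty (Policy L X) := ⟨fun _ _ => PMF.pure 0⟩
  refine ciSup_le fun π => ?_
  calc expectedSTK D k π T
      ≤ expect (historyLaw D π T) fun h =>
          (k * c : ℝ) + (((scores h).map fun x => x - c).sum : ℕ) :=
        expect_mono _ fun h => by exact_mod_cast stk_le_mul_add_sum_tsub k c (scores h)
    _ ≤ k * c + T * G := by
        rw [expect_add, expect_const]
        exact add_le_add_right (expect_sum_tsub_scores_le D π c hG T) _

theorem OPT_le_stk_add_mul [NeZero L] (D : Fin L → PMF X) {k : ℕ} (hk : 1 ≤ k) (S : Multiset ℕ)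
    {G : ℝ} (hG : ∀ l, gain D (kthLargest k S) l ≤ G) (T : ℕ) :
    OPT D k T ≤ stk k S + T * G :=
  (OPT_le_mul_add_mul D k _ hG T).trans
    (add_le_add_left (by exact_mod_cast mul_kthLargest_le_stk hk S) _)

end Gain

section Concentration

variable {L : ℕ} {X : Finset ℕ}

theorem mul_one_add_sum_le_one_of_quadratic_decay {u c : ℕ → ℝ} (hu : ∀ t, 0 ≤ u t)
    (hc : ∀ t, 0 ≤ c t) (h0 : u 0 ≤ 1) (hstep : ∀ t, u (t + 1) ≤ u t - c t * u t ^ 2) (t : ℕ) :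
    u t * (1 + ∑ i ∈ Finset.range t, c i) ≤ 1 := by
  induction t with
  | zero => simpa using h0
  | succ t ih =>
    rw [Finset.sum_range_succ]
    have sum_nonneg : 0 ≤ ∑ i ∈ Finset.range t, c i := Finset.sum_nonneg fun i _ => hc i
    set s := ∑ i ∈ Finset.range t, c i
    rcases (hu t).eq_or_lt with hut | hut
    · have : u (t + 1) ≤ 0 := by simpa [← hut] using hstep t
      nlinarith [hc t]
    · have factor_nonneg : 0 ≤ 1 - c t * u t := by
        nlinarith [hu (t + 1), hstep t]
      calc u (t + 1) * (1 + (s + c t))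
          ≤ (u t - c t * u t ^ 2) * (1 + (s + c t)) :=
            mul_le_mul_of_nonneg_right (hstep t) (by linarith [hc t])
        _ = (u t * (1 + s) + c t * u t) * (1 - c t * u t) := by ring
        _ ≤ (1 + c t * u t) * (1 - c t * u t) := by gcongr
        _ ≤ 1 := by nlinarith [sq_nonneg (c t * u t)]

theorem expect_inv_visits_extend_le (D : Fin L → PMF X) (p : PMF (Fin L)) (l : Fin L) {t : ℕ}
    (h : History L X t) :
    (expect p fun l' => expect (D l') fun x => ((visits (extend h (l', x)) l : ℝ) + 1)⁻¹)
      ≤ ((visits h l : ℝ) + 1)⁻¹ - (p l).toReal / 2 * ((visits h l : ℝ) + 1)⁻¹ ^ 2 := by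
  have inv_visits_extend (l' : Fin L) (x : X) : ((visits (extend h (l', x)) l : ℝ) + 1)⁻¹
      = (visits h l + 1 : ℝ)⁻¹
        - if l' = l then (visits h l + 1 : ℝ)⁻¹ - (visits h l + 1 + 1 : ℝ)⁻¹ else 0 := by
    rw [visits_extend]
    split_ifs <;> simp
  have decrement_ge : ((visits h l : ℝ) + 1)⁻¹ ^ 2 / 2
      ≤ (visits h l + 1 : ℝ)⁻¹ - (visits h l + 1 + 1 : ℝ)⁻¹ := by
    rw [inv_sub_inv (by positivity) (by positivity), inv_pow, ← one_div, div_div,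
      div_le_div_iff₀ (by positivity) (by positivity)]
    nlinarith
  simp only [inv_visits_extend, expect_const, expect_sub, expect_ite_eq]
  linarith [mul_le_mul_of_nonneg_left decrement_ge (ENNReal.toReal_nonneg (a := p l))]

theorem expect_inv_visits_succ_le (D : Fin L → PMF X) (π : Policy L X) (l : Fin L) (t : ℕ)
    {q : ℝ} (hq : 0 ≤ q) (hπ : ∀ h, q ≤ (π t h l).toReal) :
    expect (historyLaw D π (t + 1)) (fun h => ((visits h l : ℝ) + 1)⁻¹)
      ≤ expect (historyLaw D π t) (fun h => ((visits h l : ℝ) + 1)⁻¹)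
        - q / 2 * expect (historyLaw D π t) (fun h => ((visits h l : ℝ) + 1)⁻¹) ^ 2 :=
  calc expect (historyLaw D π (t + 1)) (fun h => ((visits h l : ℝ) + 1)⁻¹)
      ≤ expect (historyLaw D π t) (fun h =>
          ((visits h l : ℝ) + 1)⁻¹ - q / 2 * ((visits h l : ℝ) + 1)⁻¹ ^ 2) := by
        rw [expect_historyLaw_succ]
        refine expect_mono _ fun h => (expect_inv_visits_extend_le D (π t h) l h).trans ?_
        gcongr
        exact hπ h
    _ = expect (historyLaw D π t) (fun h => ((visits h l : ℝ) + 1)⁻¹)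
        - q / 2 * expect (historyLaw D π t) (fun h => ((visits h l : ℝ) + 1)⁻¹ ^ 2) := by
        rw [expect_sub, expect_const_mul]
    _ ≤ _ := by
        gcongr
        exact map_expect_le even_two.convexOn_pow _ _

theorem expect_inv_visits_mul_le_one (D : Fin L → PMF X) (π : Policy L X) (l : Fin L)
    {q : ℕ → ℝ} (hq : ∀ t, 0 ≤ q t) (hπ : ∀ t h, q t ≤ (π t h l).toReal) (t : ℕ) :
    expect (historyLaw D π t) (fun h => ((visits h l : ℝ) + 1)⁻¹)
      * (1 + ∑ i ∈ Finset.range t, q i / 2) ≤ 1 :=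
  mul_one_add_sum_le_one_of_quadratic_decay
    (u := fun t => expect (historyLaw D π t) fun h => ((visits h l : ℝ) + 1)⁻¹)
    (fun _ => expect_nonneg _ fun _ => by positivity) (fun t => div_nonneg (hq t) zero_le_two)
    (by simp [expect_historyLaw_zero, visits])
    (fun t => expect_inv_visits_succ_le D π l t (hq t) (hπ t)) t

/-- The amount by which the number of times that the arm `l` returned `x` exceeds its compensator
`D_l(x) N_l`; a martingale under every policy. -/
noncomputable def deviation (D : Fin L → PMF X) {t : ℕ} (h : History L X t) (l : Fin L) (x : X) :
    ℝ :=
  visitsWith h l x - (D l x).toReal * visits h l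

theorem deviation_extend (D : Fin L → PMF X) {t : ℕ} (h : History L X t) (l l' : Fin L)
    (x y : X) :
    deviation D (extend h (l', y)) l x = deviation D h l x
      + if l' = l then (if y = x then 1 else 0) - (D l x).toReal else 0 := by
  simp only [deviation, visits_extend, visitsWith_extend, Prod.mk.injEq]
  by_cases hl : l' = l <;> by_cases hy : y = x <;> simp [hl, hy] <;> ring

theorem expect_sq_deviation_extend_le (D : Fin L → PMF X) {t : ℕ} (h : History L X t) (l : Fin L)
    (x : X) :
    expect (D l) (fun y => deviation D (extend h (l, y)) l x ^ 2) ≤ deviation D h l x ^ 2 + 1 := by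
  set p : ℝ := (D l x).toReal with hp
  set d : ℝ := deviation D h l x
  have expand (y : X) : deviation D (extend h (l, y)) l x ^ 2
      = (d - p) ^ 2 + if y = x then 2 * (d - p) + 1 else 0 := by
    rw [deviation_extend, if_pos rfl]
    split_ifs <;> ring
  have p_nonneg : 0 ≤ p := ENNReal.toReal_nonneg
  have p_le_one : p ≤ 1 := toReal_apply_le_one _ _
  simp only [expand, expect_add, expect_const, expect_ite_eq, ← hp]
  nlinarith

theorem monotone_harmonic : Monotone harmonic :=
  monotone_nat_of_le_succ fun n => by
    rw [harmonic_succ, le_add_iff_nonneg_right]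
    positivity

/-- Sampling the arm `l` turns `d² / (N + 1)` into a value of mean at most
`(d² + 1) / (N + 2)`, and the harmonic number `H_N` into `H_N + 1 / (N + 1)`. -/
theorem expect_sq_deviation_mul_inv_visits_sub_harmonic_extend_le (D : Fin L → PMF X) (l : Fin L)
    (x : X) {t : ℕ} (h : History L X t) (l' : Fin L) :
    expect (D l') (fun y => deviation D (extend h (l', y)) l x ^ 2
        * ((visits (extend h (l', y)) l : ℝ) + 1)⁻¹
        - (harmonic (visits (extend h (l', y)) l) : ℝ))
      ≤ deviation D h l x ^ 2 * ((visits h l : ℝ) + 1)⁻¹ - (harmonic (visits h l) : ℝ) := by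
  rcases eq_or_ne l' l with rfl | hl
  · have inv_le : ((visits h l' : ℝ) + 1 + 1)⁻¹ ≤ ((visits h l' : ℝ) + 1)⁻¹ := by
      gcongr
      linarith
    have product_le := mul_le_mul inv_le (expect_sq_deviation_extend_le D h l' x)
      (expect_nonneg _ fun _ => sq_nonneg _) (by positivity)
    simp only [visits_extend, if_true, harmonic_succ, expect_sub, expect_const, mul_comm (_ ^ 2),
      expect_const_mul]
    push_cast
    linarith
  · simp [deviation_extend, visits_extend, hl, expect_const]

theorem expect_sq_deviation_mul_inv_visits_le (D : Fin L → PMF X) (π : Policy L X) (l : Fin L)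
    (x : X) (t : ℕ) :
    expect (historyLaw D π t) (fun h => deviation D h l x ^ 2 * ((visits h l : ℝ) + 1)⁻¹)
      ≤ 1 + Real.log t := by
  have supermartingale : expect (historyLaw D π t) (fun h =>
      deviation D h l x ^ 2 * ((visits h l : ℝ) + 1)⁻¹ - (harmonic (visits h l) : ℝ)) ≤ 0 :=
    (expect_historyLaw_le_of_supermartingale D π
      (f := fun _ h =>
        deviation D h l x ^ 2 * ((visits h l : ℝ) + 1)⁻¹ - (harmonic (visits h l) : ℝ))
      (fun _ h => expect_sq_deviation_mul_inv_visits_sub_harmonic_extend_le D l x h) t).trans_eq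
      (by simp [deviation, visits, visitsWith])
  have harmonic_visits_le : expect (historyLaw D π t) (fun h => (harmonic (visits h l) : ℝ))
      ≤ 1 + Real.log t :=
    expect_le_of_forall_le _ fun h =>
      (Rat.cast_le.2 (monotone_harmonic (visits_le h l))).trans (harmonic_le_one_add_log t)
  rw [expect_sub] at supermartingale
  linarith

theorem abs_visitsWith_div_visits_sub_le (D : Fin L → PMF X) {t : ℕ} (h : History L X t)
    (l : Fin L) (x : X) :
    |(visitsWith h l x : ℝ) / visits h l - (D l x).toReal|
      ≤ (2 * |deviation D h l x| + 1) * ((visits h l : ℝ) + 1)⁻¹ := by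
  rcases Nat.eq_zero_or_pos (visits h l) with h0 | h0
  · have visitsWith_eq_zero : visitsWith h l x = 0 :=
      Nat.le_zero.1 (h0 ▸ visitsWith_le_visits h l x)
    simpa [deviation, h0, visitsWith_eq_zero] using toReal_apply_le_one (D l) x
  · have one_le_visits : (1 : ℝ) ≤ visits h l := by exact_mod_cast h0
    have error_eq : (visitsWith h l x : ℝ) / visits h l - (D l x).toReal
        = deviation D h l x / visits h l := by
      rw [deviation]
      field_simp
    rw [error_eq, abs_div, abs_of_nonneg (Nat.cast_nonneg (α := ℝ) _), ← div_eq_mul_inv,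
      div_le_div_iff₀ (by linarith) (by linarith)]
    nlinarith [abs_nonneg (deviation D h l x)]

theorem abs_estimatedGain_sub_gain_le (D : Fin L → PMF X) (k : ℕ) {t : ℕ} (h : History L X t)
    (l : Fin L) :
    |estimatedGain k h l - gain D (kthLargest k (scores h)) l|
      ≤ maxScore X * ∑ x : X, (2 * |deviation D h l x| + 1) * ((visits h l : ℝ) + 1)⁻¹ := by
  simp only [estimatedGain, gain, expect, ← natCast_tsub_eq_max]
  rw [← Finset.sum_sub_distrib, Finset.mul_sum]
  refine (Finset.abs_sum_le_sum_abs _ _).trans (Finset.sum_le_sum fun x _ => ?_)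
  rw [← sub_mul, abs_mul, mul_comm, abs_of_nonneg (Nat.cast_nonneg (α := ℝ) _)]
  exact mul_le_mul (Nat.cast_le.2 (tsub_le_maxScore x _)) (abs_visitsWith_div_visits_sub_le D h l x)
    (abs_nonneg _) (Nat.cast_nonneg _)

end Concentration

section ExplorationRate

theorem coe_explorationRate (t : ℕ) : (explorationRate t : ℝ) = (t : ℝ) ^ (-(1 / 3) : ℝ) := by
  simp [explorationRate]

theorem explorationRate_succ_pos (t : ℕ) : (0 : ℝ) < explorationRate (t + 1) := by
  rw [coe_explorationRate]
  positivity

theorem coe_explorationRate_succ_le_one (t : ℕ) : (explorationRate (t + 1) : ℝ) ≤ 1 := by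
  exact_mod_cast explorationRate_le_one t

theorem antitone_explorationRate_succ : Antitone fun t => (explorationRate (t + 1) : ℝ) := by
  intro s t hst
  simp only [coe_explorationRate]
  exact Real.rpow_le_rpow_of_nonpos (by positivity) (by exact_mod_cast Nat.succ_le_succ hst)
    (by norm_num)

theorem succ_mul_explorationRate_pow_three (t : ℕ) :
    ((t : ℝ) + 1) * (explorationRate (t + 1) : ℝ) ^ 3 = 1 := by
  have h : (0 : ℝ) < (t : ℝ) + 1 := by positivity
  rw [coe_explorationRate, ← Real.rpow_natCast, ← Real.rpow_mul (by positivity)]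
  norm_num [Real.rpow_neg_one, mul_inv_cancel₀ h.ne']

theorem mul_explorationRate_le_sum (t : ℕ) :
    t * (explorationRate (t + 1) : ℝ)
      ≤ ∑ i ∈ Finset.range t, (explorationRate (i + 1) : ℝ) := by
  simpa using Finset.card_nsmul_le_sum (Finset.range t) _ _ fun i hi =>
    antitone_explorationRate_succ (Finset.mem_range.1 hi).le

theorem rpow_sub_one_le_sub_rpow_div {s : ℝ} (hs0 : 0 < s) (hs1 : s ≤ 1) {x : ℝ} (hx : 0 ≤ x) :
    (x + 1) ^ (s - 1) ≤ ((x + 1) ^ s - x ^ s) / s := by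
  have hx1 : 0 < x + 1 := by linarith
  have bernoulli := rpow_one_add_le_one_add_mul_self (s := -(x + 1)⁻¹)
    (neg_le_neg (inv_le_one_of_one_le₀ (by linarith))) hs0.le hs1
  have base_eq : 1 + -(x + 1)⁻¹ = x / (x + 1) := by
    field_simp
    ring
  rw [base_eq, Real.div_rpow hx hx1.le, div_le_iff₀ (Real.rpow_pos_of_pos hx1 s)] at bernoulli
  rw [le_div_iff₀ hs0, Real.rpow_sub_one hx1.ne', div_eq_mul_inv]
  linarith

theorem sum_rpow_sub_one_le {s : ℝ} (hs0 : 0 < s) (hs1 : s ≤ 1) (T : ℕ) :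
    ∑ t ∈ Finset.range T, ((t : ℝ) + 1) ^ (s - 1) ≤ (T : ℝ) ^ s / s := by
  calc ∑ t ∈ Finset.range T, ((t : ℝ) + 1) ^ (s - 1)
      ≤ ∑ t ∈ Finset.range T, (((t + 1 : ℕ) : ℝ) ^ s / s - (t : ℝ) ^ s / s) :=
        Finset.sum_le_sum fun t _ => by
          simpa [sub_div] using rpow_sub_one_le_sub_rpow_div hs0 hs1 t.cast_nonneg
    _ = (T : ℝ) ^ s / s := by
        rw [Finset.sum_range_sub fun t : ℕ => (t : ℝ) ^ s / s]
        simp [Real.zero_rpow hs0.ne']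

theorem sum_explorationRate_le (T : ℕ) :
    ∑ t ∈ Finset.range T, (explorationRate (t + 1) : ℝ) ≤ 3 / 2 * (T : ℝ) ^ (2 / 3 : ℝ) := by
  have h := sum_rpow_sub_one_le (s := 2 / 3) (by norm_num) (by norm_num) T
  norm_num [coe_explorationRate, div_eq_mul_inv] at h ⊢
  linarith

theorem sum_one_add_log_mul_explorationRate_le (T : ℕ) :
    ∑ t ∈ Finset.range T, (1 + Real.log t) * explorationRate (t + 1)
      ≤ (1 + Real.log T) * (3 / 2 * (T : ℝ) ^ (2 / 3 : ℝ)) := by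
  have one_add_log_le {t : ℕ} (ht : t < T) : 1 + Real.log t ≤ 1 + Real.log T := by
    rcases Nat.eq_zero_or_pos t with rfl | h0
    · simpa using Real.log_natCast_nonneg T
    · gcongr
  calc ∑ t ∈ Finset.range T, (1 + Real.log t) * explorationRate (t + 1)
      ≤ ∑ t ∈ Finset.range T, (1 + Real.log T) * explorationRate (t + 1) :=
        Finset.sum_le_sum fun t ht => mul_le_mul_of_nonneg_right
          (one_add_log_le (Finset.mem_range.1 ht)) (explorationRate_succ_pos t).le
    _ ≤ (1 + Real.log T) * (3 / 2 * (T : ℝ) ^ (2 / 3 : ℝ)) := by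
        rw [← Finset.mul_sum]
        exact mul_le_mul_of_nonneg_left (sum_explorationRate_le T)
          (by linarith [Real.log_natCast_nonneg T])

end ExplorationRate

theorem two_mul_abs_le_mul_sq_add_inv {e : ℝ} (he : 0 < e) (d : ℝ) :
    2 * |d| ≤ e * d ^ 2 + e⁻¹ := by
  have complete_square : e * d ^ 2 + e⁻¹ - 2 * |d| = e * (|d| - e⁻¹) ^ 2 := by
    rw [← sq_abs d]
    field_simp
    ring
  linarith [mul_nonneg he.le (sq_nonneg (|d| - e⁻¹))]

theorem le_pow_mul_add_sum {a δ : ℕ → ℝ} {r : ℝ} (hr0 : 0 ≤ r) (hr1 : r ≤ 1)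
    (hδ : ∀ t, 0 ≤ δ t) (h : ∀ t, a (t + 1) ≤ r * a t + δ t) (T : ℕ) :
    a T ≤ r ^ T * a 0 + ∑ t ∈ Finset.range T, δ t := by
  have gronwall := discrete_gronwall_prod_general (n₀ := 0) (fun t _ => h t) (fun _ _ => hr0)
    T.zero_le
  simp only [Finset.prod_const, Nat.card_Ico, Nat.Ico_zero_eq_range, Finset.card_range] at gronwall
  rw [mul_comm]
  exact gronwall.trans (add_le_add_right (Finset.sum_le_sum fun t _ =>
    mul_le_of_le_one_right (hδ t) (pow_le_one₀ hr0 hr1)) _)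

section EpsGreedy

variable {L : ℕ} [NeZero L] {X : Finset ℕ}

theorem expect_epsGreedy (g : Policy L X) (t : ℕ) (h : History L X t) (f : Fin L → ℝ) :
    expect (epsGreedy g t h) f
      = explorationRate (t + 1) * expect (PMF.uniformOfFintype (Fin L)) f
        + (1 - explorationRate (t + 1)) * expect (g t h) f := by
  have toReal_one_sub : ((1 : ℝ≥0∞) - (explorationRate (t + 1) : ℝ≥0∞)).toReal
      = 1 - (explorationRate (t + 1) : ℝ) := by
    rw [ENNReal.toReal_sub_of_le (ENNReal.coe_le_one_iff.2 (explorationRate_le_one t))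
      ENNReal.one_ne_top, ENNReal.toReal_one, ENNReal.coe_toReal]
  rw [epsGreedy, expect_bind]
  simp [expect, explorationCoin, toReal_one_sub]

theorem explorationRate_div_le_epsGreedy (g : Policy L X) (t : ℕ) (h : History L X t)
    (l : Fin L) : (explorationRate (t + 1) : ℝ) / L ≤ (epsGreedy g t h l).toReal := by
  have mixture := expect_epsGreedy g t h fun l' => if l' = l then 1 else 0
  simp only [expect_ite_eq, mul_one, PMF.uniformOfFintype_apply, Fintype.card_fin,
    ENNReal.toReal_inv, ENNReal.toReal_natCast] at mixture
  rw [mixture, div_eq_mul_inv, le_add_iff_nonneg_right]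
  exact mul_nonneg (sub_nonneg.2 (coe_explorationRate_succ_le_one t)) ENNReal.toReal_nonneg

theorem expect_le_expect_epsGreedy_add (g : Policy L X) (t : ℕ) (h : History L X t)
    {f : Fin L → ℝ} {M : ℝ} (hf0 : ∀ l, 0 ≤ f l) (hfM : ∀ l, f l ≤ M) :
    expect (g t h) f ≤ expect (epsGreedy g t h) f + M * explorationRate (t + 1) := by
  have exploration_nonneg :
      0 ≤ explorationRate (t + 1) * expect (PMF.uniformOfFintype (Fin L)) f :=
    mul_nonneg NNReal.zero_le_coe (expect_nonneg _ hf0)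
  have loss_le : expect (g t h) f * explorationRate (t + 1) ≤ M * explorationRate (t + 1) :=
    mul_le_mul_of_nonneg_right (expect_le_of_forall_le _ hfM) NNReal.zero_le_coe
  rw [expect_epsGreedy]
  linarith

theorem expect_inv_visits_epsGreedy_le (D : Fin L → PMF X) (g : Policy L X) (l : Fin L) (t : ℕ) :
    expect (historyLaw D (epsGreedy g) t) (fun h => ((visits h l : ℝ) + 1)⁻¹)
      ≤ 2 * L * (explorationRate (t + 1) : ℝ) ^ 2 := by
  have one_le_L : (1 : ℝ) ≤ L := by exact_mod_cast NeZero.one_le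
  have mul_le_one := expect_inv_visits_mul_le_one D (epsGreedy g) l
    (fun i => div_nonneg (explorationRate_succ_pos i).le L.cast_nonneg)
    (fun i h => explorationRate_div_le_epsGreedy g i h l) t
  have u_nonneg : 0 ≤ expect (historyLaw D (epsGreedy g) t) fun h => ((visits h l : ℝ) + 1)⁻¹ :=
    expect_nonneg _ fun _ => by positivity
  rw [← Finset.sum_div, ← Finset.sum_div] at mul_le_one
  set u := expect (historyLaw D (epsGreedy g) t) fun h => ((visits h l : ℝ) + 1)⁻¹
  set e : ℝ := (explorationRate (t + 1) : ℝ)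
  set s := ∑ i ∈ Finset.range t, (explorationRate (i + 1) : ℝ)
  have succ_mul_e_le : ((t : ℝ) + 1) * e ≤ 2 * L * (1 + s / L / 2) := by
    have : 2 * L * (1 + s / L / 2) = 2 * L + s := by field_simp
    linarith [mul_explorationRate_le_sum t, coe_explorationRate_succ_le_one t]
  calc u = u * (((t : ℝ) + 1) * e) * e ^ 2 := by
        linear_combination -u * succ_mul_explorationRate_pow_three t
    _ ≤ u * (2 * L * (1 + s / L / 2)) * e ^ 2 := by gcongr
    _ = (u * (1 + s / L / 2)) * (2 * L * e ^ 2) := by ring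
    _ ≤ 2 * L * e ^ 2 := mul_le_of_le_one_left (by positivity) mul_le_one

theorem expect_two_mul_abs_deviation_add_one_mul_inv_visits_le (D : Fin L → PMF X)
    (g : Policy L X) (l : Fin L) (x : X) (t : ℕ) :
    expect (historyLaw D (epsGreedy g) t)
        (fun h => (2 * |deviation D h l x| + 1) * ((visits h l : ℝ) + 1)⁻¹)
      ≤ (4 * L + 1) * ((1 + Real.log t) * explorationRate (t + 1)) := by
  have e_pos := explorationRate_succ_pos t
  have e_le_one := coe_explorationRate_succ_le_one t
  have log_nonneg := Real.log_natCast_nonneg t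
  set e : ℝ := (explorationRate (t + 1) : ℝ)
  have inv_visits_coeff : (e⁻¹ + 1) * (2 * L * e ^ 2) ≤ 4 * L * e :=
    calc (e⁻¹ + 1) * (2 * L * e ^ 2) = 2 * L * e * (1 + e) := by field_simp
      _ ≤ 2 * L * e * (1 + 1) := by gcongr
      _ = 4 * L * e := by ring
  calc expect (historyLaw D (epsGreedy g) t)
        (fun h => (2 * |deviation D h l x| + 1) * ((visits h l : ℝ) + 1)⁻¹)
      ≤ expect (historyLaw D (epsGreedy g) t)
        (fun h => e * (deviation D h l x ^ 2 * ((visits h l : ℝ) + 1)⁻¹)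
          + (e⁻¹ + 1) * ((visits h l : ℝ) + 1)⁻¹) := by
        refine expect_mono _ fun h => ?_
        rw [← mul_assoc, ← add_mul]
        refine mul_le_mul_of_nonneg_right ?_ (by positivity)
        linarith [two_mul_abs_le_mul_sq_add_inv e_pos (deviation D h l x)]
    _ ≤ e * (1 + Real.log t) + (e⁻¹ + 1) * (2 * L * e ^ 2) := by
        rw [expect_add, expect_const_mul, expect_const_mul]
        gcongr
        · exact expect_sq_deviation_mul_inv_visits_le D _ l x t
        · exact expect_inv_visits_epsGreedy_le D g l t
    _ ≤ e * (1 + Real.log t) + 4 * L * e * (1 + Real.log t) := by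
        have := le_mul_of_one_le_right (by positivity : 0 ≤ 4 * L * e)
          (by linarith : 1 ≤ 1 + Real.log t)
        linarith
    _ = (4 * L + 1) * ((1 + Real.log t) * e) := by ring

/-- The total error, over all arms, of the estimated marginal gains. -/
noncomputable def estimationError (D : Fin L → PMF X) (k : ℕ) {t : ℕ} (h : History L X t) : ℝ :=
  ∑ l, |estimatedGain k h l - gain D (kthLargest k (scores h)) l|

theorem expect_estimationError_le (D : Fin L → PMF X) (g : Policy L X) (k t : ℕ) :
    expect (historyLaw D (epsGreedy g) t) (fun h => estimationError D k h)
      ≤ L * (maxScore X *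
        (X.card * ((4 * L + 1) * ((1 + Real.log t) * explorationRate (t + 1))))) := by
  simp only [estimationError, expect_sum]
  refine (Finset.sum_le_card_nsmul _ _ _ fun l _ => ?_).trans_eq
    (by rw [nsmul_eq_mul, Finset.card_univ, Fintype.card_fin])
  refine (expect_mono _ fun h => abs_estimatedGain_sub_gain_le D k h l).trans ?_
  rw [expect_const_mul, expect_sum]
  gcongr
  refine (Finset.sum_le_card_nsmul _ _ _ fun x _ =>
    expect_two_mul_abs_deviation_add_one_mul_inv_visits_le D g l x t).trans_eq ?_
  rw [nsmul_eq_mul, Finset.card_univ, Fintype.card_coe]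

theorem gain_le_expect_epsGreedy_add (D : Fin L → PMF X) {k : ℕ} {g : Policy L X}
    (hg : IsGreedyRule k g) {t : ℕ} (h : History L X t) (l : Fin L) :
    gain D (kthLargest k (scores h)) l
      ≤ expect (epsGreedy g t h) (gain D (kthLargest k (scores h)))
        + maxScore X * explorationRate (t + 1) + 2 * estimationError D k h :=
  (le_expect_add_two_mul_sum_abs_sub (g t h) (hg t h) l).trans
    (add_le_add_left (expect_le_expect_epsGreedy_add g t h (gain_nonneg D _)
      (gain_le_maxScore D _)) _)

/-- The factor in front of `(1 + log t) ε_{t+1}` in the loss of one iteration of `ε`-greedy against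
the recursion `a_{t+1} ≤ (1 - 1/T) a_t` for the regret: `1` for exploring, the rest for twice the
estimation error. -/
def lossFactor (L : ℕ) (X : Finset ℕ) : ℕ :=
  maxScore X * (1 + 2 * L * X.card * (4 * L + 1))

theorem OPT_sub_expectedSTK_epsGreedy_succ_le (D : Fin L → PMF X) {k : ℕ} (hk : 1 ≤ k)
    {g : Policy L X} (hg : IsGreedyRule k g) {T : ℕ} (hT : 1 ≤ T) (t : ℕ) :
    OPT D k T - expectedSTK D k (epsGreedy g) (t + 1)
      ≤ (1 - 1 / T) * (OPT D k T - expectedSTK D k (epsGreedy g) t)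
        + lossFactor L X * ((1 + Real.log t) * explorationRate (t + 1)) := by
  have T_pos : (0 : ℝ) < T := by exact_mod_cast hT
  have gain_ge := expect_mono (historyLaw D (epsGreedy g) t) fun h =>
    OPT_le_stk_add_mul D hk (scores h) (gain_le_expect_epsGreedy_add D hg h) T
  simp only [expect_const, expect_add, expect_const_mul, ← expectedSTK_eq_expect] at gain_ge
  have estimationError_le := expect_estimationError_le D g k t
  have exploration_le : maxScore X * (explorationRate (t + 1) : ℝ)
      ≤ maxScore X * ((1 + Real.log t) * explorationRate (t + 1)) := by
    gcongr
    exact le_mul_of_one_le_left NNReal.zero_le_coe (by linarith [Real.log_natCast_nonneg t])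
  have regret_div_le := (div_le_iff₀' T_pos).2 (sub_le_iff_le_add'.2 gain_ge)
  rw [expectedSTK_succ D hk, lossFactor]
  push_cast
  linear_combination regret_div_le + exploration_le + 2 * estimationError_le

theorem OPT_sub_expectedSTK_epsGreedy_le (D : Fin L → PMF X) {k : ℕ} (hk : 1 ≤ k)
    {g : Policy L X} (hg : IsGreedyRule k g) {T : ℕ} (hT : 1 ≤ T) :
    OPT D k T - expectedSTK D k (epsGreedy g) T
      ≤ (1 - 1 / T) ^ T * OPT D k T
        + lossFactor L X * ((1 + Real.log T) * (3 / 2 * (T : ℝ) ^ (2 / 3 : ℝ))) := by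
  have inv_T_le_one : 1 / (T : ℝ) ≤ 1 := by simpa using Nat.cast_inv_le_one T
  have unrolled := le_pow_mul_add_sum
    (a := fun t => OPT D k T - expectedSTK D k (epsGreedy g) t)
    (sub_nonneg.2 inv_T_le_one) (sub_le_self 1 (by positivity))
    (fun t => by have := Real.log_natCast_nonneg t; positivity)
    (OPT_sub_expectedSTK_epsGreedy_succ_le D hk hg hT) T
  simp only [expectedSTK_zero, sub_zero, ← Finset.mul_sum] at unrolled
  refine unrolled.trans ?_
  gcongr
  exact sum_one_add_log_mul_explorationRate_le T

end EpsGreedy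

theorem one_sub_le_exp_neg_sub_sq_div_two {x : ℝ} (hx : 0 ≤ x) :
    1 - x ≤ Real.exp (-x - x ^ 2 / 2) := by
  rcases le_or_gt 1 x with hx1 | hx1
  · exact (sub_nonpos.2 hx1).trans (Real.exp_pos _).le
  have log_series := sum_le_hasSum (Finset.range 2) (fun i _ => by positivity)
    (Real.hasSum_pow_div_log_of_abs_lt_one (by rwa [abs_of_nonneg hx]))
  rw [← Real.log_le_iff_le_exp (by linarith)]
  norm_num [Finset.sum_range_succ] at log_series
  linarith

theorem one_sub_one_div_pow_le_exp {T : ℕ} (hT : 1 ≤ T) :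
    (1 - 1 / (T : ℝ)) ^ T ≤ Real.exp (-1 - 1 / (2 * (T : ℝ))) :=
  calc (1 - 1 / (T : ℝ)) ^ T ≤ Real.exp (-(1 / T) - (1 / T) ^ 2 / 2) ^ T := by
        gcongr
        · simpa using Nat.cast_inv_le_one T
        · exact one_sub_le_exp_neg_sub_sq_div_two (by positivity)
    _ = Real.exp (-1 - 1 / (2 * (T : ℝ))) := by
        rw [← Real.exp_nat_mul]
        congr 1
        field_simp

end TopKBandit

/-- The constants do not depend on the distributions, on `k`, on `T` or on the tie-breaking. -/
theorem mainTheorem1 :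
    ∃ p : ℕ, ∀ (L : ℕ) [NeZero L] (X : Finset ℕ), ∃ C : ℝ,
      ∀ (D : Fin L → PMF X) (k : ℕ), 1 ≤ k →
        ∀ g : TopKBandit.Policy L X, TopKBandit.IsGreedyRule k g →
          ∀ T : ℕ, 1 ≤ T →
            (1 - Real.exp (-1 - 1 / (2 * (T : ℝ)))) * TopKBandit.OPT D k T
                - C * (T : ℝ) ^ (2 / 3 : ℝ) * (1 + Real.log (T : ℝ)) ^ p
              ≤ TopKBandit.expectedSTK D k (TopKBandit.epsGreedy g) T := by
  refine ⟨1, fun L _ X => ⟨TopKBandit.lossFactor L X * (3 / 2), fun D k hk g hg T hT => ?_⟩⟩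
  have regret_le := TopKBandit.OPT_sub_expectedSTK_epsGreedy_le D hk hg hT
  have decay_le := mul_le_mul_of_nonneg_right (TopKBandit.one_sub_one_div_pow_le_exp hT)
    (TopKBandit.OPT_nonneg D k T)
  linarith
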